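/- Let $\ell \ge 1$ be an integer, let $\mathbf e_1,\dots,\mathbf e_\ell$ be the standard basis of $\mathbb R^\ell$, and let $$\widetilde P^\ell = \operatorname{conv}\bigl(\{\mathbf 0\}\cup\{\mathbf e_i - 2\mathbf e_j : i,j\in\{1,\dots,\ell\}\}\bigr)\subset\mathbb R^\ell$$ (the case $i=j$ is included). Let $\operatorname{Vol}$ denote $\ell$-dimensional Lebesgue measure, and for $n\ge 0$ let $D_n$ be the $n$-th central Delannoy number, that is, the number of lattice paths from $(0,0)$ to $(n,n)$ using only the steps $(1,0)$, $(0,1)$ and $(1,1)$. Then the normalized volume of $\widetilde P^\ell$ is $$\ell!\,\operatorname{Vol}(\widetilde P^\ell) = D_{\ell-1} = \sum_{k=0}^{\ell-1} 2^k\binom{\ell-1}{k}^2 .$$ -/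

import Mathlib

open MeasureTheory
open scoped Nat ENNReal

/-- The polytope `conv (0, e_i - 2 e_j : i, j ∈ [ℓ])` in `ℝ^ℓ`. The case `i = j` is allowed and
gives the point `-e_i`. -/
def tildeP (ℓ : ℕ) : Set (Fin ℓ → ℝ) :=
  convexHull ℝ
    (insert 0 {v | ∃ i j : Fin ℓ, v = Pi.single i (1 : ℝ) - (2 : ℝ) • Pi.single j (1 : ℝ)})

/-- The three kinds of steps of a Delannoy path. -/
inductive DelannoyStep : Type
  | right
  | up
  | diagonal

/-- The displacement of a step in the square grid. -/
def DelannoyStep.displacement : DelannoyStep → ℕ × ℕ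
  | .right => (1, 0)
  | .up => (0, 1)
  | .diagonal => (1, 1)

/-- The central Delannoy number `D_n`: the number of lattice paths from `(0, 0)` to `(n, n)` (each
given by its sequence of steps) that use only right, up and diagonal steps. -/
noncomputable def centralDelannoy (n : ℕ) : ℕ :=
  Set.ncard {p : List DelannoyStep | (p.map DelannoyStep.displacement).sum = (n, n)}

/-!
Let `P` and `Q` be the totals of the positive and of the negative part of a point `x` of `ℝ^ℓ`.
The points `e_i - 2 e_j` have convex hull `Δ - 2 Δ`, where `Δ` is the standard simplex, and the
polytope is the cone from the origin over this set. Therefore `x` lies in it iff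
`2 P ≤ Q ≤ 1 + P` (`tildeP_eq`): with `t = Q - P`, the remaining masses `t - P` and `2 t - Q` needed to write `x = u - 2 v` with
`u, v ∈ t Δ` are equal and cancel.

The volume then depends only on the joint distribution of `(P, Q)` under Lebesgue measure. On the
points with `i` positive and `j` negative coordinates the two totals are independent with densities
`p ^ (i - 1) / (i - 1)!` and `q ^ (j - 1) / (j - 1)!`, and there are `C(ℓ, i)` choices of the signs
(`lintegral_posPart_negPart`). Integrating over `q` leaves one integral over `p ∈ [0, 1]` for each
`i` (`volume_tildeP`).

With `n = ℓ - 1`, an integration by parts brings the sum of these integrals, multiplied by `ℓ!`,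
into the form `1 + ∫₀¹ H'(p) dp` with `H(p) = ∑ C(n, i)² pⁱ (1 + p)^(n - i)`. As `H(0) = 1`, the
result is `H(1) = ∑ C(n, i)² 2^(n - i)` (`sum_choose_mul_integral_pow`).

The same sum counts Delannoy paths: `∑ 2ᵏ C(a, k) C(b, k)` satisfies the recurrence obtained by
removing the first step of a path to `(a, b)` (`encard_delannoyPaths`).
-/

open Finset.HasAntidiagonal (antidiagonal)

/-! ### Delannoy paths -/

/-- The closed form `∑ₖ 2ᵏ C(a, k) C(b, k)` for the number of Delannoy paths from `(0, 0)` to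
`(a, b)`. -/
def delannoySum (a b : ℕ) : ℕ :=
  ∑ k ∈ Finset.range (a + 1), 2 ^ k * a.choose k * b.choose k

theorem delannoySum_zero_left (b : ℕ) : delannoySum 0 b = 1 := by
  simp [delannoySum]

theorem delannoySum_zero_right (a : ℕ) : delannoySum a 0 = 1 := by
  simp [delannoySum, Finset.sum_range_succ']

theorem delannoySum_eq_of_le {a N : ℕ} (b : ℕ) (h : a + 1 ≤ N) :
    delannoySum a b = ∑ k ∈ Finset.range N, 2 ^ k * a.choose k * b.choose k := by
  unfold delannoySum
  apply Finset.sum_subset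
  · intro x; simp only [Finset.mem_range]; omega
  · intro k _ hk
    rw [Nat.choose_eq_zero_of_lt (by simpa using hk)]; simp

theorem delannoySum_succ_left (a b : ℕ) : delannoySum (a + 1) b =
    delannoySum a b + ∑ k ∈ Finset.range (a + 1), 2 ^ (k + 1) * a.choose k * b.choose (k + 1) := by
  rw [delannoySum_eq_of_le b (by omega : a + 1 ≤ a + 2), delannoySum,
    Finset.sum_range_succ', Finset.sum_range_succ' _ (a + 1), add_right_comm,
    ← Finset.sum_add_distrib]
  simp only [Nat.choose_zero_right, add_left_inj]
  refine Finset.sum_congr rfl fun k _ => ?_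
  rw [Nat.choose_succ_succ]; ring

theorem delannoySum_succ_succ (a b : ℕ) : delannoySum (a + 1) (b + 1) =
    delannoySum a (b + 1) + delannoySum (a + 1) b + delannoySum a b := by
  rw [delannoySum_succ_left a (b + 1), delannoySum_succ_left a b]
  have : ∑ k ∈ Finset.range (a + 1), 2 ^ (k + 1) * a.choose k * (b + 1).choose (k + 1) =
      2 * delannoySum a b +
        ∑ k ∈ Finset.range (a + 1), 2 ^ (k + 1) * a.choose k * b.choose (k + 1) := by
    rw [delannoySum, Finset.mul_sum, ← Finset.sum_add_distrib]
    refine Finset.sum_congr rfl fun k _ => ?_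
    rw [Nat.choose_succ_succ]; ring
  rw [this]; ring

/-- The Delannoy paths from `(0, 0)` to `v`. -/
def delannoyPaths (v : ℕ × ℕ) : Set (List DelannoyStep) :=
  {p | (p.map DelannoyStep.displacement).sum = v}

/-- A nonempty path to `(a, b)` is its first step followed by a path to the remaining
displacement, which is the recurrence of `delannoySum_succ_succ`. -/
theorem encard_delannoyPaths (a b : ℕ) :
    (delannoyPaths (a, b)).encard = (delannoySum a b : ℕ∞) := by
  have inj (s : DelannoyStep) : Function.Injective (List.cons s) := List.cons_injective
  induction a generalizing b with
  | zero =>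
    induction b with
    | zero =>
      have : delannoyPaths (0, 0) = {[]} := by
        ext p
        rcases p with _ | ⟨s, p⟩
        · simp [delannoyPaths, Prod.ext_iff]
        · cases s <;> simp [delannoyPaths, DelannoyStep.displacement, Prod.ext_iff]
      rw [this]; simp [delannoySum]
    | succ b ih =>
      have : delannoyPaths (0, b + 1) = List.cons .up '' delannoyPaths (0, b) := by
        ext p
        rcases p with _ | ⟨s, p⟩
        · simp [delannoyPaths, Prod.ext_iff]
        · cases s <;> simp [delannoyPaths, DelannoyStep.displacement, Prod.ext_iff]
          omega
      rw [this, (inj _).encard_image, ih, delannoySum_zero_left, delannoySum_zero_left]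
  | succ a iha =>
    induction b with
    | zero =>
      have : delannoyPaths (a + 1, 0) = List.cons .right '' delannoyPaths (a, 0) := by
        ext p
        rcases p with _ | ⟨s, p⟩
        · simp [delannoyPaths, Prod.ext_iff]
        · cases s <;> simp [delannoyPaths, DelannoyStep.displacement, Prod.ext_iff]
          omega
      rw [this, (inj _).encard_image, iha, delannoySum_zero_right, delannoySum_zero_right]
    | succ b ihb =>
      have : delannoyPaths (a + 1, b + 1) = List.cons .right '' delannoyPaths (a, b + 1) ∪
          List.cons .up '' delannoyPaths (a + 1, b) ∪
          List.cons .diagonal '' delannoyPaths (a, b) := by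
        ext p
        rcases p with _ | ⟨s, p⟩
        · simp [delannoyPaths, Prod.ext_iff]
        · cases s <;> simp [delannoyPaths, DelannoyStep.displacement, Prod.ext_iff] <;> omega
      rw [this, Set.encard_union_eq, Set.encard_union_eq, (inj _).encard_image,
        (inj _).encard_image, (inj _).encard_image, iha, iha, ihb, delannoySum_succ_succ]
      · push_cast; rfl
      · rw [Set.disjoint_left]; rintro _ ⟨p, _, rfl⟩ ⟨q, _, h⟩; simp at h
      · rw [Set.disjoint_left]; rintro _ (⟨p, _, rfl⟩ | ⟨p, _, rfl⟩) ⟨q, _, h⟩ <;> simp at h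

theorem centralDelannoy_eq_sum (n : ℕ) :
    centralDelannoy n = ∑ k ∈ Finset.range (n + 1), 2 ^ k * n.choose k ^ 2 := by
  have h := encard_delannoyPaths n n
  rw [centralDelannoy, Set.ncard_def]
  change (delannoyPaths (n, n)).encard.toNat = _
  rw [h, ENat.toNat_natCast, delannoySum]
  exact Finset.sum_congr rfl fun k _ => by ring

/-! ### Description of the polytope by inequalities -/

theorem sum_posPart_sub_sum_negPart {ι : Type*} [Fintype ι] (x : ι → ℝ) :
    ∑ i, (x i)⁺ - ∑ i, (x i)⁻ = ∑ i, x i := by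
  rw [← Finset.sum_sub_distrib]
  exact Finset.sum_congr rfl fun i _ => posPart_sub_negPart (x i)

/-- A point whose coordinates are those of `u - 2 v`, with `u` and `v` in the standard simplex,
is a convex combination of the points `e_i - 2 e_j`, with weights `u_i v_j`. -/
theorem sub_two_smul_mem_tildeP {ℓ : ℕ} {u v : Fin ℓ → ℝ} (hu : ∀ i, 0 ≤ u i) (hv : ∀ i, 0 ≤ v i)
    (hu1 : ∑ i, u i = 1) (hv1 : ∑ i, v i = 1) : u - (2 : ℝ) • v ∈ tildeP ℓ := by
  have key : u - (2 : ℝ) • v = ∑ ij : Fin ℓ × Fin ℓ, (u ij.1 * v ij.2) •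
      ((Pi.single ij.1 1 - (2 : ℝ) • Pi.single ij.2 1 : Fin ℓ → ℝ)) := by
    ext c
    simp only [Pi.sub_apply, Pi.smul_apply, smul_eq_mul, Finset.sum_apply, mul_sub,
      Finset.sum_sub_distrib, Fintype.sum_prod_type, Pi.single_apply]
    simp only [mul_ite, mul_one, mul_zero, Finset.sum_ite_eq, Finset.mem_univ, if_true]
    congr 1
    · rw [Finset.sum_comm]
      simp [← Finset.mul_sum, hv1]
    · rw [← Finset.sum_mul, ← Finset.sum_mul, hu1]; ring
  rw [key]
  refine (convex_convexHull ℝ _).sum_mem (fun ij _ => mul_nonneg (hu _) (hv _)) ?_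
    fun ij _ => subset_convexHull ℝ _ (Or.inr ⟨ij.1, ij.2, rfl⟩)
  rw [Fintype.sum_prod_type]
  simp [← Finset.mul_sum, hu1, hv1]

/-- The polytope is the set of points whose positive part has total `P` and whose negative part
has total `Q` with `2 P ≤ Q ≤ 1 + P`. -/
theorem tildeP_eq {ℓ : ℕ} (hℓ : 1 ≤ ℓ) : tildeP ℓ =
    {x | 2 * ∑ i, (x i)⁺ ≤ ∑ i, (x i)⁻ ∧ ∑ i, (x i)⁻ ≤ 1 + ∑ i, (x i)⁺} := by
  apply Set.Subset.antisymm
  · apply convexHull_min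
    · rintro x (rfl | ⟨i, j, rfl⟩)
      · simp
      · set x : Fin ℓ → ℝ := Pi.single i (1 : ℝ) - (2 : ℝ) • Pi.single j (1 : ℝ) with hx
        have hs : ∑ c, x c = -1 := by
          simp [hx, ← Finset.mul_sum]; norm_num
        have hp : ∑ c, (x c)⁺ ≤ 1 := by
          calc ∑ c, (x c)⁺ ≤ ∑ c, (Pi.single i (1 : ℝ) : Fin ℓ → ℝ) c := by
                refine Finset.sum_le_sum fun c _ => ?_
                have h1 : 0 ≤ (Pi.single i (1 : ℝ) : Fin ℓ → ℝ) c := by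
                  rw [Pi.single_apply]; split_ifs <;> norm_num
                have h2 : 0 ≤ (Pi.single j (1 : ℝ) : Fin ℓ → ℝ) c := by
                  rw [Pi.single_apply]; split_ifs <;> norm_num
                rw [posPart_def]
                refine sup_le ?_ h1
                simp only [hx, Pi.sub_apply, Pi.smul_apply, smul_eq_mul]
                linarith
            _ = 1 := by simp
        have := sum_posPart_sub_sum_negPart x
        constructor <;> linarith
    · intro x hx y hy a b ha hb hab
      have h1 := sum_posPart_sub_sum_negPart x
      have h2 := sum_posPart_sub_sum_negPart y
      have h3 := sum_posPart_sub_sum_negPart (a • x + b • y)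
      have h4 : ∑ i, (a • x + b • y) i = a * ∑ i, x i + b * ∑ i, y i := by
        simp [Finset.sum_add_distrib, Finset.mul_sum]
      have h5 : ∑ i, ((a • x + b • y) i)⁺ ≤ a * ∑ i, (x i)⁺ + b * ∑ i, (y i)⁺ := by
        rw [Finset.mul_sum, Finset.mul_sum, ← Finset.sum_add_distrib]
        refine Finset.sum_le_sum fun i _ => ?_
        rw [posPart_def]
        refine sup_le ?_ (by positivity)
        simp only [Pi.add_apply, Pi.smul_apply, smul_eq_mul]
        gcongr <;> exact le_posPart _
      obtain ⟨hx1, hx2⟩ := hx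
      obtain ⟨hy1, hy2⟩ := hy
      have ex1 := mul_nonneg ha (sub_nonneg.2 hx1)
      have ex2 := mul_nonneg ha (sub_nonneg.2 hx2)
      have ey1 := mul_nonneg hb (sub_nonneg.2 hy1)
      have ey2 := mul_nonneg hb (sub_nonneg.2 hy2)
      rw [h4, ← h1, ← h2] at h3
      constructor <;> nlinarith
  · rintro x ⟨h1, h2⟩
    have h0 := sum_posPart_sub_sum_negPart x
    set P := ∑ i, (x i)⁺ with hP
    set Q := ∑ i, (x i)⁻ with hQ
    have hP0 : 0 ≤ P := Finset.sum_nonneg fun i _ => posPart_nonneg _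
    have hℓ' : (0 : ℝ) < ℓ := by exact_mod_cast hℓ
    have hzero : (0 : Fin ℓ → ℝ) ∈ tildeP ℓ := subset_convexHull ℝ _ (Or.inl rfl)
    rcases eq_or_lt_of_le (show 0 ≤ Q - P by linarith) with ht | ht
    · have hQ0 : Q = 0 := by linarith
      have hP0 : P = 0 := by linarith
      rw [hP, Finset.sum_eq_zero_iff_of_nonneg fun i _ => posPart_nonneg _] at hP0
      rw [hQ, Finset.sum_eq_zero_iff_of_nonneg fun i _ => negPart_nonneg _] at hQ0
      have : x = 0 := by
        ext i
        rw [← posPart_sub_negPart (x i), hP0 i (Finset.mem_univ i), hQ0 i (Finset.mem_univ i)]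
        simp
      rw [this]; exact hzero
    · -- Pad `x⁺` and `x⁻` by the same constant, so that their totals become `t` and `2 t`.
      set t := Q - P with htdef
      have hc : 0 ≤ (t - P) / ℓ := div_nonneg (by linarith) hℓ'.le
      have hmem : (fun i => ((x i)⁺ + (t - P) / ℓ) / t) -
          (2 : ℝ) • (fun i => ((x i)⁻ + (t - P) / ℓ) / (2 * t)) ∈ tildeP ℓ := by
        refine sub_two_smul_mem_tildeP
          (fun i => div_nonneg (add_nonneg (posPart_nonneg _) hc) ht.le)
          (fun i => div_nonneg (add_nonneg (negPart_nonneg _) hc) (by linarith)) ?_ ?_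
        · rw [← Finset.sum_div, Finset.sum_add_distrib, ← hP]
          simp only [Finset.sum_const, Finset.card_univ, Fintype.card_fin, nsmul_eq_mul]
          field_simp
          ring
        · rw [← Finset.sum_div, Finset.sum_add_distrib, ← hQ]
          simp only [Finset.sum_const, Finset.card_univ, Fintype.card_fin, nsmul_eq_mul]
          field_simp
          linarith
      have hx : x = t • ((fun i => ((x i)⁺ + (t - P) / ℓ) / t) -
          (2 : ℝ) • (fun i => ((x i)⁻ + (t - P) / ℓ) / (2 * t))) + (1 - t) • 0 := by
        ext i
        simp only [Pi.add_apply, Pi.smul_apply, Pi.sub_apply, smul_eq_mul, Pi.zero_apply]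
        have := posPart_sub_negPart (x i)
        field_simp
        linear_combination (-(ℓ : ℝ)) * this
      rw [hx]
      exact convex_convexHull ℝ _ hmem hzero ht.le (by linarith) (by ring)

/-! ### The joint distribution of the totals of the positive and negative parts -/

/-- The distribution of the sum of `k` nonnegative coordinates under Lebesgue measure: the point
mass at `0` for `k = 0`, and the density `p ^ (k - 1) / (k - 1)!` on `(0, ∞)` for `k ≥ 1`. -/
noncomputable def orthantSumMeasure : ℕ → Measure ℝ
  | 0 => Measure.dirac 0
  | k + 1 => (volume.restrict (Set.Ioi 0)).withDensity fun p => ENNReal.ofReal (p ^ k / k !)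

instance (k : ℕ) : SFinite (orthantSumMeasure k) := by
  cases k <;> unfold orthantSumMeasure <;> infer_instance

theorem lintegral_orthantSumMeasure_zero (g : ℝ → ℝ≥0∞) :
    ∫⁻ p, g p ∂orthantSumMeasure 0 = g 0 :=
  lintegral_dirac _ _

theorem lintegral_orthantSumMeasure_succ (k : ℕ) {g : ℝ → ℝ≥0∞} (hg : Measurable g) :
    ∫⁻ p, g p ∂orthantSumMeasure (k + 1) =
      ∫⁻ p in Set.Ioi 0, ENNReal.ofReal (p ^ k / k !) * g p := by
  rw [orthantSumMeasure, lintegral_withDensity_eq_lintegral_mul _ (by fun_prop) hg]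
  rfl

theorem integral_pow_div_factorial (m : ℕ) (a b : ℝ) :
    ∫ p in a..b, p ^ m / m ! = (b ^ (m + 1) - a ^ (m + 1)) / (m + 1)! := by
  rw [intervalIntegral.integral_div, integral_pow, Nat.factorial_succ]
  push_cast
  rw [div_div]

theorem lintegral_Ioc_eq_ofReal_integral {f : ℝ → ℝ} (hf : Continuous f) {a b : ℝ} (hab : a ≤ b)
    (h0 : ∀ x ∈ Set.Ioc a b, 0 ≤ f x) :
    ∫⁻ x in Set.Ioc a b, ENNReal.ofReal (f x) = ENNReal.ofReal (∫ x in a..b, f x) := by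
  rw [intervalIntegral.integral_of_le hab, ofReal_integral_eq_lintegral_ofReal]
  · exact (hf.intervalIntegrable a b).1
  · exact (ae_restrict_iff' measurableSet_Ioc).2 (Filter.Eventually.of_forall h0)

/-- Adding one more nonnegative coordinate turns `orthantSumMeasure k` into
`orthantSumMeasure (k + 1)`. -/
theorem lintegral_Ioi_lintegral_orthantSumMeasure (k : ℕ) {g : ℝ → ℝ≥0∞} (hg : Measurable g) :
    ∫⁻ a in Set.Ioi 0, ∫⁻ p, g (p + a) ∂orthantSumMeasure k =
      ∫⁻ p, g p ∂orthantSumMeasure (k + 1) := by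
  rw [lintegral_orthantSumMeasure_succ k hg]
  cases k with
  | zero => simp [lintegral_orthantSumMeasure_zero]
  | succ k =>
    have h1 (a : ℝ) : ∫⁻ p, g (p + a) ∂orthantSumMeasure (k + 1) =
        ∫⁻ p in Set.Ioi 0, ENNReal.ofReal (p ^ k / k !) * g (p + a) :=
      lintegral_orthantSumMeasure_succ k (by fun_prop)
    simp_rw [h1]
    rw [lintegral_lintegral_swap (by fun_prop)]
    -- Substitute `u = p + a` and integrate over `0 < p < u` in the other order.
    have h2 (p : ℝ) : ∫⁻ a in Set.Ioi 0, ENNReal.ofReal (p ^ k / k !) * g (p + a) =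
        ∫⁻ u, (Set.Ioi p).indicator (fun u => ENNReal.ofReal (p ^ k / k !) * g u) u := by
      rw [← lintegral_indicator measurableSet_Ioi,
        ← lintegral_add_left_eq_self
          ((Set.Ioi p).indicator fun u => ENNReal.ofReal (p ^ k / k !) * g u) p]
      refine lintegral_congr fun a => ?_
      simp [Set.indicator_apply]
    simp_rw [h2]
    have hmeas : MeasurableSet {z : ℝ × ℝ | z.1 < z.2} :=
      measurableSet_lt measurable_fst measurable_snd
    rw [lintegral_lintegral_swap]
    · rw [← lintegral_indicator measurableSet_Ioi]
      refine lintegral_congr fun u => ?_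
      by_cases hu : 0 < u
      · rw [Set.indicator_of_mem (Set.mem_Ioi.2 hu)]
        have h3 (p : ℝ) : (Set.Ioi p).indicator (fun u => ENNReal.ofReal (p ^ k / k !) * g u) u =
            (Set.Iio u).indicator (fun p => ENNReal.ofReal (p ^ k / k !) * g u) p := by
          simp [Set.indicator_apply]
        simp_rw [h3]
        rw [setLIntegral_indicator measurableSet_Iio, Set.inter_comm, Set.Ioi_inter_Iio,
          lintegral_mul_const _ (by fun_prop), setLIntegral_congr Ioo_ae_eq_Ioc,
          lintegral_Ioc_eq_ofReal_integral (by fun_prop) hu.le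
            (fun p hp => by have := hp.1; positivity), integral_pow_div_factorial]
        simp
      · rw [Set.indicator_of_notMem (by simpa using hu)]
        refine (setLIntegral_congr_fun measurableSet_Ioi fun p hp => ?_).trans (lintegral_zero)
        have : p ∈ Set.Ioi (0 : ℝ) := hp
        rw [Set.mem_Ioi] at this
        exact Set.indicator_of_notMem (by simp only [Set.mem_Ioi]; linarith) _
    · have : (Function.uncurry fun p u : ℝ =>
          (Set.Ioi p).indicator (fun u => ENNReal.ofReal (p ^ k / k !) * g u) u) =
          {z : ℝ × ℝ | z.1 < z.2}.indicator
            fun z => ENNReal.ofReal (z.1 ^ k / k !) * g z.2 := by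
        ext ⟨p, u⟩
        simp [Set.indicator_apply, Function.uncurry]
      rw [this]
      exact (Measurable.indicator (by fun_prop) hmeas).aemeasurable

theorem lintegral_eq_Ioi_add_Ioi_neg {h : ℝ → ℝ≥0∞} :
    ∫⁻ a, h a = (∫⁻ a in Set.Ioi 0, h a) + ∫⁻ a in Set.Ioi 0, h (-a) := by
  rw [← lintegral_add_compl h (measurableSet_Ioi (a := (0 : ℝ))), Set.compl_Ioi,
    setLIntegral_congr Iio_ae_eq_Iic.symm]
  congr 1
  rw [← lintegral_indicator measurableSet_Iio, ← lintegral_indicator measurableSet_Ioi,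
    ← lintegral_neg_eq_self]
  refine lintegral_congr fun a => ?_
  simp [Set.indicator_apply]

/-- Under Lebesgue measure on `ℝ^ℓ`, the totals of the positive and of the negative part have joint
distribution `∑ C(ℓ, i) γ_i × γ_j` over `i + j = ℓ`, where `i` counts the positive coordinates and
`γ` is `orthantSumMeasure`. -/
theorem lintegral_posPart_negPart (ℓ : ℕ) {f : ℝ × ℝ → ℝ≥0∞} (hf : Measurable f) :
    ∫⁻ x : Fin ℓ → ℝ, f (∑ i, (x i)⁺, ∑ i, (x i)⁻) =
      ∑ ij ∈ antidiagonal ℓ, ℓ.choose ij.1 •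
        ∫⁻ p, ∫⁻ q, f (p, q) ∂orthantSumMeasure ij.2 ∂orthantSumMeasure ij.1 := by
  induction ℓ generalizing f with
  | zero => simp [lintegral_orthantSumMeasure_zero, lintegral_unique, volume_pi]
  | succ n ih =>
    have hpos : Measurable fun a : ℝ => a⁺ := measurable_id.sup_const 0
    have hneg : Measurable fun a : ℝ => a⁻ := measurable_id.neg.sup_const 0
    -- Split off the first coordinate `a` and distinguish its sign: `a > 0` raises the number of
    -- positive coordinates, `a < 0` that of negative ones, and Pascal's rule adds the two.
    have hmp := (volume_preserving_piFinSuccAbove (fun _ : Fin (n + 1) => ℝ) 0).symm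
    rw [← hmp.lintegral_comp_emb (MeasurableEquiv.measurableEmbedding _)]
    have hx (z : ℝ × (Fin n → ℝ)) :
        f (∑ i, ((MeasurableEquiv.piFinSuccAbove (fun _ : Fin (n + 1) => ℝ) 0).symm z i)⁺,
          ∑ i, ((MeasurableEquiv.piFinSuccAbove (fun _ : Fin (n + 1) => ℝ) 0).symm z i)⁻) =
        f (∑ i, (z.2 i)⁺ + z.1⁺, ∑ i, (z.2 i)⁻ + z.1⁻) := by
      rw [Fin.sum_univ_succ, Fin.sum_univ_succ, add_comm, add_comm (_⁻)]
      rfl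
    simp_rw [hx]
    rw [Measure.volume_eq_prod, lintegral_prod _ (by
      refine (hf.comp ?_).aemeasurable
      fun_prop)]
    have hstep (a : ℝ) : ∫⁻ y : Fin n → ℝ, f (∑ i, (y i)⁺ + a⁺, ∑ i, (y i)⁻ + a⁻) =
        ∑ ij ∈ antidiagonal n, n.choose ij.1 •
          ∫⁻ p, ∫⁻ q, f (p + a⁺, q + a⁻) ∂orthantSumMeasure ij.2 ∂orthantSumMeasure ij.1 :=
      ih (f := fun z => f (z.1 + a⁺, z.2 + a⁻)) (by fun_prop)
    simp only [hstep]
    rw [lintegral_eq_Ioi_add_Ioi_neg, Finset.sum_antidiagonal_choose_succ_nsmul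
      (fun i j => ∫⁻ p, ∫⁻ q, f (p, q) ∂orthantSumMeasure j ∂orthantSumMeasure i), add_comm]
    congr 1
    · rw [setLIntegral_congr_fun (g := fun a => ∑ ij ∈ antidiagonal n, n.choose ij.1 •
          ∫⁻ p, ∫⁻ q, f (p, q + a) ∂orthantSumMeasure ij.2 ∂orthantSumMeasure ij.1)
          measurableSet_Ioi (fun a ha => by
            have ha' : (0 : ℝ) < a := ha
            simp [posPart_of_nonpos, negPart_of_nonpos, ha'.le])]
      rw [lintegral_finsetSum _ (by intro ij _; simp only [nsmul_eq_mul]; fun_prop)]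
      refine Finset.sum_congr rfl fun ij _ => ?_
      simp only [nsmul_eq_mul]
      rw [lintegral_const_mul _ (by fun_prop), lintegral_lintegral_swap (by fun_prop)]
      congr 1
      refine lintegral_congr fun p => ?_
      exact lintegral_Ioi_lintegral_orthantSumMeasure ij.2 (g := fun q => f (p, q)) (by fun_prop)
    · rw [setLIntegral_congr_fun (g := fun a => ∑ ij ∈ antidiagonal n, n.choose ij.1 •
          ∫⁻ p, ∫⁻ q, f (p + a, q) ∂orthantSumMeasure ij.2 ∂orthantSumMeasure ij.1)
          measurableSet_Ioi (fun a ha => by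
            have ha' : (0 : ℝ) < a := ha
            simp [ha'.le, posPart_of_nonneg, negPart_of_nonneg])]
      rw [lintegral_finsetSum _ (by intro ij _; simp only [nsmul_eq_mul]; fun_prop)]
      refine Finset.sum_congr rfl fun ij hij => ?_
      simp only [nsmul_eq_mul]
      rw [lintegral_const_mul _ (by fun_prop)]
      rw [Nat.choose_symm_of_eq_add (Finset.HasAntidiagonal.mem_antidiagonal.1 hij).symm]
      congr 1
      exact lintegral_Ioi_lintegral_orthantSumMeasure ij.1
        (g := fun p => ∫⁻ q, f (p, q) ∂orthantSumMeasure ij.2) (by fun_prop)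

/-! ### Evaluation of the integrals -/

/-- Integrate the derivative of `p ^ (i + 1) * (1 + p) ^ j - 2 ^ j * p ^ (i + j + 1)`, which
vanishes at both ends. For `j = 0` both sides are `0`. -/
theorem integral_pow_mul_sub (i j : ℕ) :
    ∫ p in (0 : ℝ)..1, p ^ i * ((1 + p) ^ j - (2 * p) ^ j) =
      j / (i + j + 1) * ∫ p in (0 : ℝ)..1, p ^ i * (1 + p) ^ (j - 1) := by
  have hne : (i + j + 1 : ℝ) ≠ 0 := by positivity
  have hd (p : ℝ) : HasDerivAt (fun p : ℝ => p ^ (i + 1) * (1 + p) ^ j - 2 ^ j * p ^ (i + j + 1))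
      ((i + j + 1) * (p ^ i * ((1 + p) ^ j - (2 * p) ^ j)) -
        j * (p ^ i * (1 + p) ^ (j - 1))) p := by
    have h1 : HasDerivAt (fun p : ℝ => 1 + p) 1 p := (hasDerivAt_id p).const_add 1
    refine (((hasDerivAt_pow (i + 1) p).fun_mul (h1.fun_pow j)).fun_sub
      ((hasDerivAt_pow (i + j + 1) p).const_mul (2 ^ j))).congr_deriv ?_
    rcases j with _ | j
    · simp
    · simp only [Nat.add_sub_cancel]
      push_cast
      ring
  have h := intervalIntegral.integral_eq_sub_of_hasDerivAt (a := 0) (b := 1) (fun p _ => hd p)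
    (Continuous.intervalIntegrable (by fun_prop) _ _)
  rw [intervalIntegral.integral_sub (Continuous.intervalIntegrable (by fun_prop) _ _)
    (Continuous.intervalIntegrable (by fun_prop) _ _), intervalIntegral.integral_const_mul,
    intervalIntegral.integral_const_mul] at h
  norm_num at h
  rw [div_mul_eq_mul_div, eq_div_iff hne]
  linarith

/-- The polynomial `∑ C(n, i)² pⁱ (1 + p)ʲ` over `i + j = n`, at `p = 1`, is obtained by integrating
its derivative. -/
theorem sum_choose_mul_integral (n : ℕ) :
    1 + ∑ ij ∈ antidiagonal n, (ij.2 * (n + 1).choose (ij.1 + 1) * n.choose ij.1 : ℝ) *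
      ∫ p in (0 : ℝ)..1, p ^ ij.1 * (1 + p) ^ (ij.2 - 1) =
    ∑ ij ∈ antidiagonal n, (n.choose ij.1 : ℝ) ^ 2 * 2 ^ ij.2 := by
  have hd (p : ℝ) : HasDerivAt
      (fun p : ℝ => ∑ ij ∈ antidiagonal n, (n.choose ij.1 : ℝ) ^ 2 *
        (p ^ ij.1 * (1 + p) ^ ij.2))
      (∑ ij ∈ antidiagonal n, (ij.2 * (n + 1).choose (ij.1 + 1) * n.choose ij.1 : ℝ) *
        (p ^ ij.1 * (1 + p) ^ (ij.2 - 1))) p := by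
    have h1 : HasDerivAt (fun p : ℝ => 1 + p) 1 p := (hasDerivAt_id p).const_add 1
    refine (HasDerivAt.fun_sum (u := antidiagonal n) fun ij _ =>
      ((hasDerivAt_pow ij.1 p).fun_mul (h1.fun_pow ij.2)).const_mul
        ((n.choose ij.1 : ℝ) ^ 2)).congr_deriv ?_
    rcases n with _ | r
    · simp
    · simp only [mul_add, Finset.sum_add_distrib]
      rw [Finset.Nat.sum_antidiagonal_succ (n := r), Finset.Nat.sum_antidiagonal_succ' (n := r),
        Finset.Nat.sum_antidiagonal_succ' (n := r)]
      simp only [Nat.cast_zero, zero_mul, mul_zero, zero_add, ← Finset.sum_add_distrib]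
      refine Finset.sum_congr rfl fun ij hij => ?_
      -- The coefficient of `pⁱ (1 + p)ʲ` on the left uses `(i + 1) C(r + 1, i + 1) =
      -- (j + 1) C(r + 1, i)`, then Pascal's rule gives `C(r + 2, i + 1)`.
      obtain ⟨i, j⟩ := ij
      have hij' : i + j = r := Finset.HasAntidiagonal.mem_antidiagonal.1 hij
      have hc := Nat.choose_succ_right_eq (r + 1) i
      rw [show r + 1 - i = j + 1 by omega] at hc
      have hc' : ((r + 1).choose (i + 1) : ℝ) * (i + 1) = (r + 1).choose i * (j + 1) := by
        exact_mod_cast hc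
      rw [Nat.choose_succ_succ (r + 1) i]
      simp only [Nat.add_sub_cancel]
      push_cast
      linear_combination (((r + 1).choose (i + 1) : ℝ) * p ^ i * (1 + p) ^ j) * hc'
  have h := intervalIntegral.integral_eq_sub_of_hasDerivAt (a := 0) (b := 1) (fun p _ => hd p)
    (Continuous.intervalIntegrable (by fun_prop) _ _)
  rw [intervalIntegral.integral_finsetSum
    (fun _ _ => Continuous.intervalIntegrable (by fun_prop) _ _)] at h
  simp only [intervalIntegral.integral_const_mul] at h
  rw [h]
  have h0 : ∑ ij ∈ antidiagonal n, (n.choose ij.1 : ℝ) ^ 2 *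
      ((0 : ℝ) ^ ij.1 * (1 + 0) ^ ij.2) = 1 := by
    rw [Finset.sum_eq_single (0, n)]
    · simp
    · rintro ⟨i, j⟩ hij hne
      have hij' : i + j = n := Finset.HasAntidiagonal.mem_antidiagonal.1 hij
      have : i ≠ 0 := by
        rintro rfl
        exact hne (by simp at hij'; simp [hij'])
      simp [this]
    · simp
  rw [h0]
  norm_num

/-- The volume, summed over the number of positive coordinates and normalized by `(n + 1)!`, is
the Delannoy sum. -/
theorem sum_choose_mul_integral_pow (n : ℕ) :
    ((n + 1)! : ℝ) * (1 / (n + 1)! + ∑ ij ∈ antidiagonal n, (n + 1).choose (ij.1 + 1) *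
      ∫ p in (0 : ℝ)..1, p ^ ij.1 / ij.1 ! * (((1 + p) ^ ij.2 - (2 * p) ^ ij.2) / ij.2 !)) =
    ∑ k ∈ Finset.range (n + 1), 2 ^ k * (n.choose k : ℝ) ^ 2 := by
  have hR : ∑ k ∈ Finset.range (n + 1), 2 ^ k * (n.choose k : ℝ) ^ 2 =
      ∑ ij ∈ antidiagonal n, (n.choose ij.1 : ℝ) ^ 2 * 2 ^ ij.2 := by
    rw [← Finset.Nat.sum_antidiagonal_swap, Finset.Nat.sum_antidiagonal_eq_sum_range_succ_mk]
    refine Finset.sum_congr rfl fun k hk => ?_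
    simp only [Prod.fst_swap, Prod.snd_swap]
    rw [Nat.choose_symm (by simpa [Nat.lt_succ_iff] using hk)]
    ring
  have hfac : ((n + 1)! : ℝ) ≠ 0 := by positivity
  rw [hR, ← sum_choose_mul_integral, mul_add, mul_one_div_cancel hfac, Finset.mul_sum]
  congr 1
  refine Finset.sum_congr rfl fun ij hij => ?_
  obtain ⟨i, j⟩ := ij
  obtain rfl : i + j = n := Finset.HasAntidiagonal.mem_antidiagonal.1 hij
  have h1 : ∫ p in (0 : ℝ)..1, p ^ i / i ! * (((1 + p) ^ j - (2 * p) ^ j) / j !) =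
      (1 / (i ! * j !)) * ∫ p in (0 : ℝ)..1, p ^ i * ((1 + p) ^ j - (2 * p) ^ j) := by
    rw [← intervalIntegral.integral_const_mul]
    congr 1
    ext p
    field_simp
  simp only [h1, integral_pow_mul_sub]
  have h2 : ((i + j).choose i : ℝ) * i ! * j ! = (i + j)! := by
    exact_mod_cast Nat.choose_symm_add (a := i) (b := j) ▸
      Nat.add_choose_mul_factorial_mul_factorial i j
  rw [Nat.factorial_succ]
  push_cast
  rw [← h2]
  field_simp

/-! ### The volume of the polytope -/

/-- For `m = 0` the atom at `0` has to be kept out of the interval, hence `hm`. -/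
theorem orthantSumMeasure_Icc {m : ℕ} {a b : ℝ} (ha : 0 ≤ a) (hab : a ≤ b) (hm : m ≠ 0 ∨ 0 < a) :
    orthantSumMeasure m (Set.Icc a b) = ENNReal.ofReal ((b ^ m - a ^ m) / m !) := by
  rw [← lintegral_indicator_one measurableSet_Icc]
  rcases m with _ | m
  · have ha' : 0 < a := by simpa using hm
    -- The point mass at `0` misses the interval; the right-hand side is `(1 - 1) / 0! = 0`.
    rw [lintegral_orthantSumMeasure_zero, Set.indicator_of_notMem (by simp [ha'])]
    simp
  · rw [lintegral_orthantSumMeasure_succ m (measurable_one.indicator measurableSet_Icc),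
      ← integral_pow_div_factorial, ← lintegral_Ioc_eq_ofReal_integral (by fun_prop) hab
        (fun p hp => by have := ha.trans hp.1.le; positivity)]
    have h (p : ℝ) : ENNReal.ofReal (p ^ m / m !) * (Set.Icc a b).indicator 1 p =
        (Set.Icc a b).indicator (fun p => ENNReal.ofReal (p ^ m / m !)) p := by
      simp [Set.indicator_apply]
    simp_rw [h]
    rw [setLIntegral_congr Ioi_ae_eq_Ici, setLIntegral_indicator measurableSet_Icc,
      Set.inter_eq_left.2 (Set.Icc_subset_Ici_self.trans (Set.Ici_subset_Ici.2 ha)),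
      setLIntegral_congr Ioc_ae_eq_Icc]

/-- The region of the pairs `(P, Q)` in the description of the polytope by the totals `P` and `Q`
of the positive and of the negative part. -/
def totalsRegion : Set (ℝ × ℝ) := {z | 2 * z.1 ≤ z.2 ∧ z.2 ≤ 1 + z.1}

theorem measurableSet_totalsRegion : MeasurableSet totalsRegion :=
  (measurableSet_le (f := fun z : ℝ × ℝ => 2 * z.1) (g := fun z => z.2)
    (by fun_prop) (by fun_prop)).inter
    (measurableSet_le (f := fun z : ℝ × ℝ => z.2) (g := fun z => 1 + z.1)
      (by fun_prop) (by fun_prop))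

theorem lintegral_totalsRegion_slice (m : ℕ) (p : ℝ) :
    ∫⁻ q, totalsRegion.indicator 1 (p, q) ∂orthantSumMeasure m =
      orthantSumMeasure m (Set.Icc (2 * p) (1 + p)) := by
  rw [← lintegral_indicator_one measurableSet_Icc]
  rfl

theorem slice_integrand_nonneg (i j : ℕ) {p : ℝ} (hp0 : 0 ≤ p) (hp1 : p ≤ 1) :
    0 ≤ p ^ i / i ! * (((1 + p) ^ j - (2 * p) ^ j) / j !) := by
  have : (2 * p) ^ j ≤ (1 + p) ^ j := by gcongr; linarith
  exact mul_nonneg (by positivity) (div_nonneg (by linarith) (by positivity))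

/-- The contribution of the points without positive coordinates. -/
theorem lintegral_totalsRegion_zero (n : ℕ) :
    ∫⁻ p, ∫⁻ q, totalsRegion.indicator 1 (p, q) ∂orthantSumMeasure (n + 1) ∂orthantSumMeasure 0 =
      ENNReal.ofReal (1 / (n + 1)!) := by
  rw [lintegral_orthantSumMeasure_zero, lintegral_totalsRegion_slice,
    orthantSumMeasure_Icc (by norm_num) (by norm_num) (by simp)]
  simp

/-- The contribution of the points with `i + 1` positive and `j` nonpositive coordinates. -/
theorem lintegral_totalsRegion_succ (i j : ℕ) :
    ∫⁻ p, ∫⁻ q, totalsRegion.indicator 1 (p, q) ∂orthantSumMeasure j ∂orthantSumMeasure (i + 1) =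
      ENNReal.ofReal (∫ p in (0 : ℝ)..1,
        p ^ i / i ! * (((1 + p) ^ j - (2 * p) ^ j) / j !)) := by
  have hmeas : Measurable fun p => ∫⁻ q, totalsRegion.indicator 1 (p, q) ∂orthantSumMeasure j :=
    Measurable.lintegral_prod_right'
      (f := totalsRegion.indicator 1) (measurable_one.indicator measurableSet_totalsRegion)
  rw [lintegral_orthantSumMeasure_succ i hmeas, ← lintegral_Ioc_eq_ofReal_integral (by fun_prop)
      zero_le_one, ← lintegral_indicator measurableSet_Ioi, ← lintegral_indicator measurableSet_Ioc]
  · refine lintegral_congr fun p => ?_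
    simp only [lintegral_totalsRegion_slice]
    by_cases hp : 0 < p
    · rw [Set.indicator_of_mem (Set.mem_Ioi.2 hp)]
      by_cases hp1 : p ≤ 1
      · rw [Set.indicator_of_mem (Set.mem_Ioc.2 ⟨hp, hp1⟩),
          orthantSumMeasure_Icc (by linarith) (by linarith) (Or.inr (by linarith)),
          ← ENNReal.ofReal_mul (by positivity)]
      · rw [Set.indicator_of_notMem fun h => hp1 h.2, Set.Icc_eq_empty (by linarith)]
        simp
    · rw [Set.indicator_of_notMem (mt Set.mem_Ioi.1 hp),
        Set.indicator_of_notMem fun h => hp h.1]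
  · exact fun p hp => slice_integrand_nonneg i j hp.1.le hp.2

/-- The polytope is the preimage of `totalsRegion` under the two totals, so its volume is the sum
of the contributions according to the number of positive coordinates. The term without negative
coordinates, `i = n` and `j = 0`, vanishes. -/
theorem volume_tildeP (n : ℕ) : volume (tildeP (n + 1)) =
    ENNReal.ofReal (1 / (n + 1)! + ∑ ij ∈ antidiagonal n, (n + 1).choose (ij.1 + 1) *
      ∫ p in (0 : ℝ)..1,
        p ^ ij.1 / ij.1 ! * (((1 + p) ^ ij.2 - (2 * p) ^ ij.2) / ij.2 !)) := by
  have hpos : Measurable fun a : ℝ => a⁺ := measurable_id.sup_const 0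
  have hneg : Measurable fun a : ℝ => a⁻ := measurable_id.neg.sup_const 0
  have hset : tildeP (n + 1) =
      (fun x : Fin (n + 1) → ℝ => (∑ i, (x i)⁺, ∑ i, (x i)⁻)) ⁻¹' totalsRegion :=
    tildeP_eq (Nat.le_add_left 1 n)
  have hnonneg (i j : ℕ) :
      0 ≤ ∫ p in (0 : ℝ)..1, p ^ i / i ! * (((1 + p) ^ j - (2 * p) ^ j) / j !) :=
    intervalIntegral.integral_nonneg zero_le_one fun p hp => slice_integrand_nonneg i j hp.1 hp.2
  rw [← lintegral_indicator_one
    (hset ▸ measurableSet_totalsRegion.preimage (by fun_prop)), hset]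
  have h := lintegral_posPart_negPart (n + 1)
    (f := totalsRegion.indicator 1) (measurable_one.indicator measurableSet_totalsRegion)
  refine Eq.trans ?_ (h.trans ?_)
  · rfl
  · rw [Finset.Nat.sum_antidiagonal_succ]
    simp only [lintegral_totalsRegion_zero, lintegral_totalsRegion_succ, Nat.choose_zero_right,
      one_smul, nsmul_eq_mul]
    rw [ENNReal.ofReal_add (by positivity)
      (Finset.sum_nonneg fun ij _ => mul_nonneg (by positivity) (hnonneg _ _)),
      ENNReal.ofReal_sum_of_nonneg fun ij _ => mul_nonneg (by positivity) (hnonneg _ _)]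
    congr 1
    refine Finset.sum_congr rfl fun ij _ => ?_
    rw [ENNReal.ofReal_mul (by positivity), ENNReal.ofReal_natCast]

theorem mainTheorem8 (ℓ : ℕ) (hℓ : 1 ≤ ℓ) :
    (ℓ ! : ℝ≥0∞) * volume (tildeP ℓ) = (centralDelannoy (ℓ - 1) : ℝ≥0∞) ∧
      centralDelannoy (ℓ - 1) = ∑ k ∈ Finset.range ℓ, 2 ^ k * (ℓ - 1).choose k ^ 2 := by
  obtain ⟨n, rfl⟩ : ∃ n, ℓ = n + 1 := ⟨ℓ - 1, by omega⟩
  rw [Nat.add_sub_cancel]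
  refine ⟨?_, centralDelannoy_eq_sum n⟩
  rw [volume_tildeP, ← ENNReal.ofReal_natCast, ← ENNReal.ofReal_mul (by positivity),
    sum_choose_mul_integral_pow, centralDelannoy_eq_sum, ← ENNReal.ofReal_natCast]
  push_cast
  rfl
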